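/- There are numerical constants $C_0 > 0$ and $c > 0$ such that the following holds. Let $L_0 \in \mathbb{R}^{n_1 \times n_2}$ be a matrix of rank $r$ with singular value decomposition $L_0 = U \Sigma V^*$, where $U \in \mathbb{R}^{n_1 \times r}$ and $V \in \mathbb{R}^{n_2 \times r}$ have orthonormal columns and $\Sigma$ is diagonal with positive diagonal entries, and suppose that $L_0$ is incoherent with parameter $\mu$, i.e. $$\max_i \|U^* e_i\|^2 \le \frac{\mu r}{n_1}, \qquad \max_j \|V^* e_j\|^2 \le \frac{\mu r}{n_2}, \qquad \max_{i,j} |(UV^*)_{ij}| \le \sqrt{\frac{\mu r}{n_1 n_2}}.$$ Let $\mathcal{P}_T$ be the orthogonal projection (for the Frobenius inner product) onto $T = \{U X^* + Y V^* : X \in \mathbb{R}^{n_2 \times r},\ Y \in \mathbb{R}^{n_1 \times r}\}$. Let $\Omega \sim \mathrm{Ber}(\rho)$, i.e. $\Omega \subset [n_1] \times [n_2]$ is a random set containing each entry $(i,j)$ independently with probability $\rho \in [0,1]$, and let $\mathcal{P}_\Omega$ be the orthogonal projection onto the matrices supported on $\Omega$. Write $n_{(1)} = \max(n_1,n_2)$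 and $n_{(2)} = \min(n_1,n_2)$, and let $\epsilon > 0$. If $$1 - \rho \ \ge\ C_0\, \epsilon^{-2}\, \frac{\mu r \log n_{(1)}}{n_{(2)}},$$ then with probability at least $1 - c\, n_{(1)}^{-10}$, $$\|\mathcal{P}_\Omega \mathcal{P}_T\|^2 \le \rho + \epsilon,$$ where $\|\cdot\|$ is the operator norm with respect to the Frobenius norm. In particular, for square matrices ($n_1 = n_2 = n$) the condition reads $1 - \rho \ge C_0\, \epsilon^{-2} \mu r \log n / n$ and the probability is at least $1 - c\, n^{-10}$. -/

import Mathlib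

open MeasureTheory ProbabilityTheory

/-- Real `n₁ × n₂` matrices, seen as long vectors: the Euclidean norm and inner product are the
Frobenius norm and inner product. -/
abbrev MatSpace (n₁ n₂ : ℕ) : Type := EuclideanSpace ℝ (Fin n₁ × Fin n₂)

/-- `L = U Σ Vᵀ = ∑ₖ σₖ uₖ vₖᵀ` is a (reduced) singular value decomposition: `U` and `V` have
orthonormal columns and all `σₖ` are positive. The number `r` of terms is then the rank of `L`. -/
structure IsReducedSVD {n₁ n₂ r : ℕ} (L : Matrix (Fin n₁) (Fin n₂) ℝ)
    (U : Matrix (Fin n₁) (Fin r) ℝ) (σ : Fin r → ℝ) (V : Matrix (Fin n₂) (Fin r) ℝ) : Prop where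
  orthonormal_left : U.transpose * U = 1
  orthonormal_right : V.transpose * V = 1
  pos : ∀ k, 0 < σ k
  eq : L = U * Matrix.diagonal σ * V.transpose

/-- The incoherence condition with parameter `μ`:
`maxᵢ ‖Uᵀ eᵢ‖² ≤ μ r / n₁`, `maxⱼ ‖Vᵀ eⱼ‖² ≤ μ r / n₂` and
`maxᵢⱼ |(U Vᵀ)ᵢⱼ| ≤ √(μ r / (n₁ n₂))`. -/
structure IsIncoherent {n₁ n₂ r : ℕ} (U : Matrix (Fin n₁) (Fin r) ℝ)
    (V : Matrix (Fin n₂) (Fin r) ℝ) (μ : ℝ) : Prop where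
  left : ∀ i, ∑ k, U i k ^ 2 ≤ μ * r / n₁
  right : ∀ j, ∑ k, V j k ^ 2 ≤ μ * r / n₂
  sup : ∀ i j, |(U * V.transpose) i j| ≤ Real.sqrt (μ * r / (n₁ * n₂))

/-- The linear space `T = {U Xᵀ + Y Vᵀ}`. -/
def tangentSpace {n₁ n₂ r : ℕ} (U : Matrix (Fin n₁) (Fin r) ℝ) (V : Matrix (Fin n₂) (Fin r) ℝ) :
    Submodule ℝ (MatSpace n₁ n₂) where
  carrier := {Z | ∃ (X : Matrix (Fin n₂) (Fin r) ℝ) (Y : Matrix (Fin n₁) (Fin r) ℝ),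
    ∀ i j, Z (i, j) = (U * X.transpose + Y * V.transpose) i j}
  add_mem' := by
    rintro Z Z' ⟨X, Y, h⟩ ⟨X', Y', h'⟩
    refine ⟨X + X', Y + Y', fun i j => ?_⟩
    rw [PiLp.add_apply, h, h', Matrix.transpose_add, Matrix.mul_add, Matrix.add_mul]
    simp only [Matrix.add_apply]
    ring
  zero_mem' := ⟨0, 0, fun i j => by simp⟩
  smul_mem' := by
    rintro c Z ⟨X, Y, h⟩
    refine ⟨c • X, c • Y, fun i j => ?_⟩
    rw [PiLp.smul_apply, h, Matrix.transpose_smul, Matrix.mul_smul, Matrix.smul_mul, ← smul_add,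
      Matrix.smul_apply]

/-- The linear space of matrices supported on the set `S` of entries. -/
def supportedOn {n₁ n₂ : ℕ} (S : Set (Fin n₁ × Fin n₂)) : Submodule ℝ (MatSpace n₁ n₂) where
  carrier := {Z | ∀ p, p ∉ S → Z p = 0}
  add_mem' := by
    intro Z Z' h h' p hp
    rw [PiLp.add_apply, h p hp, h' p hp, add_zero]
  zero_mem' := fun p _ => by simp
  smul_mem' := by
    intro c Z h p hp
    rw [PiLp.smul_apply, h p hp, smul_zero]

/-- The composition `P_S ∘ P_T` of the orthogonal projection onto `T` followed by the orthogonal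
projection onto the matrices supported on `S`. Its norm is the operator norm with respect to the
Frobenius norm. -/
noncomputable def projSupportTangent {n₁ n₂ r : ℕ} (S : Set (Fin n₁ × Fin n₂))
    (U : Matrix (Fin n₁) (Fin r) ℝ) (V : Matrix (Fin n₂) (Fin r) ℝ) :
    MatSpace n₁ n₂ →L[ℝ] MatSpace n₁ n₂ :=
  (supportedOn S).starProjection ∘L (tangentSpace U V).starProjection

/-! Let `Q` be the matrix of `P_T` in the basis of matrix units, with rows `w_p`. Since `Q` is a
symmetric idempotent, `P_T P_Ω P_T = ∑_{p ∈ Ω} w_p w_pᵀ`, while `∑_p w_p w_pᵀ = Q` and `|w_p|² = Q p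
p ≤ K`, with `K` of order `μ r / n₍₂₎` by incoherence. The claim is thus a Chernoff bound for the
top eigenvalue of a random sum of rank one matrices.

The trace exponential moment is controlled one entry at a time, using only calculus along rank one
updates. For `R` positive semidefinite put `f(s) = tr exp(R + s w wᵀ)` and `q = f'`, so `q(s) = wᵀ
exp(R + s w wᵀ) w`. Chebyshev's inequality for spectral moments gives `0 ≤ q' ≤ K q`, hence `q(0) ≤
q(s) ≤ e^{Ks} q(0)`. Therefore `(1 - ρ) f(0) + ρ f(θ) ≤ f(κ)` with `κ = ρ (e^{Kθ} - 1) / K`: each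
random coefficient may be replaced by the constant `κ`. The final matrix is `κ Q`, with trace
exponential at most `n₁ n₂ e^κ`, and Markov's inequality at level `t = ρ + ε` finishes.

The exponential is replaced by Taylor polynomials, so that only derivatives of matrix powers occur;
the limit is taken on a scalar inequality. -/

/-! ### Spectral moments of positive semidefinite matrices -/

open Matrix Finset in
/-- A positive semidefinite real matrix has nonnegative spectral weights computing the traces and
the quadratic forms of its powers. -/
theorem Matrix.PosSemidef.exists_spectral_weights {ι : Type*} [Fintype ι] [DecidableEq ι]
    {B : Matrix ι ι ℝ} (hB : B.PosSemidef) :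
    ∃ (l : ι → ℝ) (c : (ι → ℝ) → ι → ℝ), (∀ k, 0 ≤ l k) ∧
      (∀ m : ℕ, (B ^ m).trace = ∑ k, l k ^ m) ∧
      ∀ w (m : ℕ), w ⬝ᵥ (B ^ m *ᵥ w) = ∑ k, l k ^ m * c w k ^ 2 := by
  set Q : Matrix ι ι ℝ := (hB.1.eigenvectorUnitary : Matrix ι ι ℝ) with hQ
  have h1 : Qᵀ * Q = 1 := by
    have := Unitary.coe_star_mul_self hB.1.eigenvectorUnitary
    simpa [Matrix.star_eq_conjTranspose] using this
  have h2 : Q * Qᵀ = 1 := by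
    have := Unitary.coe_mul_star_self hB.1.eigenvectorUnitary
    simpa [Matrix.star_eq_conjTranspose] using this
  have hBQ : B = Q * diagonal hB.1.eigenvalues * Qᵀ := by
    have := hB.1.spectral_theorem
    rw [Unitary.conjStarAlgAut_apply] at this
    simpa [Matrix.star_eq_conjTranspose, Function.comp_def] using this
  have hpow (m : ℕ) : B ^ m = Q * diagonal (fun k => hB.1.eigenvalues k ^ m) * Qᵀ := by
    induction m with
    | zero => simp [h2]
    | succ m ih =>
      calc B ^ (m + 1) = Q * diagonal (fun k => hB.1.eigenvalues k ^ m) * Qᵀ *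
            (Q * diagonal hB.1.eigenvalues * Qᵀ) := by rw [pow_succ, ih, ← hBQ]
        _ = Q * diagonal (fun k => hB.1.eigenvalues k ^ m) * (Qᵀ * Q) *
            diagonal hB.1.eigenvalues * Qᵀ := by simp only [Matrix.mul_assoc]
        _ = _ := by
          rw [h1, Matrix.mul_one, Matrix.mul_assoc Q, diagonal_mul_diagonal]
          simp only [pow_succ]
  refine ⟨hB.1.eigenvalues, fun w => Qᵀ *ᵥ w, hB.eigenvalues_nonneg, fun m => ?_, fun w m => ?_⟩
  · rw [hpow, trace_mul_comm, ← Matrix.mul_assoc, h1, Matrix.one_mul, trace_diagonal]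
  · rw [hpow, ← mulVec_mulVec, ← mulVec_mulVec, dotProduct_mulVec, ← mulVec_transpose]
    simp only [dotProduct, mulVec_diagonal]
    exact sum_congr rfl fun k _ => by ring

open Matrix Finset in
theorem Matrix.PosSemidef.dotProduct_pow_mulVec_nonneg {ι : Type*} [Fintype ι] [DecidableEq ι]
    {B : Matrix ι ι ℝ} (hB : B.PosSemidef) (w : ι → ℝ) (m : ℕ) :
    0 ≤ w ⬝ᵥ (B ^ m *ᵥ w) := by
  obtain ⟨l, c, hl, -, hc⟩ := hB.exists_spectral_weights
  rw [hc]
  exact sum_nonneg fun k _ => mul_nonneg (pow_nonneg (hl k) _) (sq_nonneg _)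

open Matrix Finset in
/-- Chebyshev's inequality for the spectral moments of a positive semidefinite matrix. -/
theorem Matrix.PosSemidef.dotProduct_pow_mulVec_mul_le {ι : Type*} [Fintype ι] [DecidableEq ι]
    {B : Matrix ι ι ℝ} (hB : B.PosSemidef) (w : ι → ℝ) (i j : ℕ) :
    (w ⬝ᵥ (B ^ i *ᵥ w)) * (w ⬝ᵥ (B ^ j *ᵥ w)) ≤ (w ⬝ᵥ w) * (w ⬝ᵥ (B ^ (i + j) *ᵥ w)) := by
  obtain ⟨l, c, hl, -, hc⟩ := hB.exists_spectral_weights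
  have h0 := hc w 0
  simp only [pow_zero, one_mulVec, one_mul] at h0
  rw [hc, hc, hc, h0]
  -- Symmetrization: on nonnegative eigenvalues both powers are monotone, so the two differences
  -- have the same sign.
  have key : 0 ≤ ∑ a, ∑ b, c w a ^ 2 * c w b ^ 2 *
      ((l a ^ i - l b ^ i) * (l a ^ j - l b ^ j)) := by
    refine sum_nonneg fun a _ => sum_nonneg fun b _ => mul_nonneg (by positivity) ?_
    rcases le_total (l a) (l b) with h | h
    · exact mul_nonneg_of_nonpos_of_nonpos (sub_nonpos.2 (pow_le_pow_left₀ (hl a) h i))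
        (sub_nonpos.2 (pow_le_pow_left₀ (hl a) h j))
    · exact mul_nonneg (sub_nonneg.2 (pow_le_pow_left₀ (hl b) h i))
        (sub_nonneg.2 (pow_le_pow_left₀ (hl b) h j))
  have expand : ∑ a, ∑ b, c w a ^ 2 * c w b ^ 2 * ((l a ^ i - l b ^ i) * (l a ^ j - l b ^ j)) =
      2 * ((∑ k, c w k ^ 2) * ∑ k, l k ^ (i + j) * c w k ^ 2) -
      2 * ((∑ k, l k ^ i * c w k ^ 2) * ∑ k, l k ^ j * c w k ^ 2) := by
    have e1 := sum_mul_sum univ univ (fun k => c w k ^ 2) (fun k => l k ^ (i + j) * c w k ^ 2)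
    have e2 := sum_mul_sum univ univ (fun k => l k ^ (i + j) * c w k ^ 2) (fun k => c w k ^ 2)
    have e3 := sum_mul_sum univ univ (fun k => l k ^ i * c w k ^ 2) (fun k => l k ^ j * c w k ^ 2)
    have e4 := sum_mul_sum univ univ (fun k => l k ^ j * c w k ^ 2) (fun k => l k ^ i * c w k ^ 2)
    rw [two_mul, two_mul]
    nth_rewrite 2 [mul_comm]
    nth_rewrite 4 [mul_comm]
    rw [e1, e2, e3, e4]
    simp only [← sum_add_distrib, ← sum_sub_distrib]
    exact sum_congr rfl fun a _ => sum_congr rfl fun b _ => by ring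
  linarith

-- By the moment inequality, a Rayleigh quotient at least `t` for `B` forces one at least `t ^ m`
-- for `B ^ m`, and no Rayleigh quotient exceeds the trace.
open Matrix Finset in
theorem Matrix.PosSemidef.pow_le_trace_pow {ι : Type*} [Fintype ι] [DecidableEq ι]
    {B : Matrix ι ι ℝ} (hB : B.PosSemidef) {x : ι → ℝ} {t : ℝ} (ht : 0 ≤ t) (hx : 0 < x ⬝ᵥ x)
    (h : t * (x ⬝ᵥ x) ≤ x ⬝ᵥ (B *ᵥ x)) (m : ℕ) : t ^ m ≤ (B ^ m).trace := by
  have hpow : t ^ m * (x ⬝ᵥ x) ≤ x ⬝ᵥ (B ^ m *ᵥ x) := by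
    induction m with
    | zero => simp
    | succ m ih =>
      have h1 := hB.dotProduct_pow_mulVec_mul_le x m 1
      rw [pow_one] at h1
      have h2 := mul_le_mul ih h (mul_nonneg ht hx.le) (hB.dotProduct_pow_mulVec_nonneg x m)
      refine le_of_mul_le_mul_left ?_ hx
      calc (x ⬝ᵥ x) * (t ^ (m + 1) * (x ⬝ᵥ x)) = t ^ m * (x ⬝ᵥ x) * (t * (x ⬝ᵥ x)) := by ring
        _ ≤ _ := h2.trans h1
  obtain ⟨l, c, hl, htr, hc⟩ := hB.exists_spectral_weights
  have h0 := hc x 0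
  simp only [pow_zero, one_mulVec, one_mul] at h0
  refine le_of_mul_le_mul_right (hpow.trans ?_) hx
  rw [hc, htr, sum_mul]
  refine sum_le_sum fun k _ => mul_le_mul_of_nonneg_left ?_ (pow_nonneg (hl k) _)
  rw [h0]
  exact single_le_sum (f := fun k => c x k ^ 2) (fun k _ => sq_nonneg _) (mem_univ k)

/-! ### Truncated exponentials and their derivatives along rank one updates -/

open Matrix Finset in
/-- The Taylor polynomial of degree `M - 1` of the trace exponential. -/
noncomputable def traceExpPoly {ι : Type*} [Fintype ι] [DecidableEq ι] (M : ℕ)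
    (B : Matrix ι ι ℝ) : ℝ := ∑ m ∈ range M, (B ^ m).trace / (m.factorial : ℝ)

open Matrix Finset in
/-- The quadratic form at `w` of the Taylor polynomial of degree `M - 1` of the exponential. -/
noncomputable def quadExpPoly {ι : Type*} [Fintype ι] [DecidableEq ι] (M : ℕ) (w : ι → ℝ)
    (B : Matrix ι ι ℝ) : ℝ := ∑ m ∈ range M, (w ⬝ᵥ (B ^ m *ᵥ w)) / (m.factorial : ℝ)

section Derivatives

open Matrix Finset

attribute [local instance] Matrix.linftyOpNormedRing Matrix.linftyOpNormedAlgebra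

theorem Matrix.hasDerivAt_pow_add_smul {ι : Type*} [Fintype ι] [DecidableEq ι]
    (R W : Matrix ι ι ℝ) (m : ℕ) (s : ℝ) (φ : Matrix ι ι ℝ →ₗ[ℝ] ℝ) :
    HasDerivAt (fun s : ℝ => φ ((R + s • W) ^ m))
      (∑ i ∈ range m, φ ((R + s • W) ^ (m - 1 - i) * W * (R + s • W) ^ i)) s := by
  have h : HasDerivAt (fun s : ℝ => R + s • W) W s := by
    exact (((hasDerivAt_id s).smul_const W).const_add R).congr_deriv (one_smul ℝ W)
  have h2 := (LinearMap.toContinuousLinearMap φ).hasFDerivAt.comp_hasDerivAt s (h.fun_pow' m)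
  exact h2.congr_deriv (map_sum φ _ _)

end Derivatives

-- By cyclicity of the trace the `m` terms in the derivative of the `m`-th power coincide, and `m /
-- m! = 1 / (m - 1)!`; this lowers the truncation from `M + 1` to `M`.
open Matrix Finset in
theorem hasDerivAt_traceExpPoly {ι : Type*} [Fintype ι] [DecidableEq ι]
    (R : Matrix ι ι ℝ) (w : ι → ℝ) (M : ℕ) (s : ℝ) :
    HasDerivAt (fun s : ℝ => traceExpPoly (M + 1) (R + s • vecMulVec w w))
      (quadExpPoly M w (R + s • vecMulVec w w)) s := by
  have h (m : ℕ) := (Matrix.hasDerivAt_pow_add_smul R (vecMulVec w w) m s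
    (traceLinearMap ι ℝ ℝ)).div_const (m.factorial : ℝ)
  have h2 := HasDerivAt.fun_sum (u := range (M + 1)) fun m _ => h m
  refine h2.congr_deriv ?_
  rw [sum_range_succ', quadExpPoly]
  simp only [range_zero, sum_empty, zero_div, add_zero, traceLinearMap_apply]
  refine sum_congr rfl fun m _ => ?_
  rw [sum_congr rfl (g := fun _ => w ⬝ᵥ ((R + s • vecMulVec w w) ^ m *ᵥ w)), sum_const, card_range,
    Nat.factorial_succ]
  · push_cast
    field_simp
    simp
  · intro i hi
    rw [trace_mul_comm, ← Matrix.mul_assoc, ← pow_add, mul_vecMulVec, trace_vecMulVec,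
      dotProduct_comm]
    congr 3
    have := mem_range.1 hi
    omega

open Matrix Finset in
theorem hasDerivAt_quadExpPoly {ι : Type*} [Fintype ι] [DecidableEq ι]
    (R : Matrix ι ι ℝ) (w : ι → ℝ) (M : ℕ) (s : ℝ) :
    HasDerivAt (fun s : ℝ => quadExpPoly M w (R + s • vecMulVec w w))
      (∑ m ∈ range M, (∑ i ∈ range m, (w ⬝ᵥ ((R + s • vecMulVec w w) ^ (m - 1 - i) *ᵥ w)) *
        (w ⬝ᵥ ((R + s • vecMulVec w w) ^ i *ᵥ w))) / (m.factorial : ℝ)) s := by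
  let φ : Matrix ι ι ℝ →ₗ[ℝ] ℝ :=
    { toFun := fun B => w ⬝ᵥ (B *ᵥ w)
      map_add' := fun A B => by rw [add_mulVec, dotProduct_add]
      map_smul' := fun c B => by rw [smul_mulVec, dotProduct_smul]; rfl }
  have h (m : ℕ) := (Matrix.hasDerivAt_pow_add_smul R (vecMulVec w w) m s φ).div_const
    (m.factorial : ℝ)
  have h2 := HasDerivAt.fun_sum (u := range M) fun m _ => h m
  refine h2.congr_deriv (sum_congr rfl fun m _ => ?_)
  congr 1
  refine sum_congr rfl fun i _ => ?_
  change w ⬝ᵥ (_ *ᵥ w) = _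
  rw [← mulVec_mulVec, ← mulVec_mulVec, vecMulVec_mulVec, mulVec_smul, dotProduct_smul]
  simp [mul_comm]

/-! ### Differential inequalities for rank one updates -/

open Matrix in
theorem Matrix.PosSemidef.add_smul_vecMulVec {ι : Type*} [Fintype ι] {R : Matrix ι ι ℝ}
    (hR : R.PosSemidef) (w : ι → ℝ) {s : ℝ} (hs : 0 ≤ s) :
    (R + s • vecMulVec w w).PosSemidef := by
  refine hR.add (PosSemidef.smul ?_ hs)
  simpa using posSemidef_vecMulVec_self_star w

open Matrix Finset in
theorem traceExpPoly_nonneg {ι : Type*} [Fintype ι] [DecidableEq ι] {B : Matrix ι ι ℝ}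
    (hB : B.PosSemidef) (M : ℕ) : 0 ≤ traceExpPoly M B := by
  obtain ⟨l, -, hl, htr, -⟩ := hB.exists_spectral_weights
  refine sum_nonneg fun m _ => div_nonneg ?_ (Nat.cast_nonneg _)
  rw [htr]
  exact sum_nonneg fun k _ => pow_nonneg (hl k) m

-- This is `q' ≤ K q`: each of the `m` products is at most `K` times the moment of order `m - 1`,
-- and the factor `m` turns `1 / m!` into `1 / (m - 1)!`.
open Matrix Finset in
theorem sum_moment_convolution_le {ι : Type*} [Fintype ι] [DecidableEq ι] {B : Matrix ι ι ℝ}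
    (hB : B.PosSemidef) {w : ι → ℝ} {K : ℝ} (hw : w ⬝ᵥ w ≤ K) (M : ℕ) :
    ∑ m ∈ range M, (∑ i ∈ range m, (w ⬝ᵥ (B ^ (m - 1 - i) *ᵥ w)) * (w ⬝ᵥ (B ^ i *ᵥ w))) /
      (m.factorial : ℝ) ≤ K * quadExpPoly M w B := by
  have hK : 0 ≤ K := (by simpa using hB.dotProduct_pow_mulVec_nonneg w 0 : 0 ≤ w ⬝ᵥ w).trans hw
  cases M with
  | zero => simp [quadExpPoly]
  | succ M =>
    rw [sum_range_succ', quadExpPoly, sum_range_succ, mul_add, mul_sum]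
    refine add_le_add (sum_le_sum fun m _ => ?_) ?_
    · rw [Nat.factorial_succ, ← mul_div_assoc,
        div_le_div_iff₀ (by positivity) (by positivity)]
      have : ∑ i ∈ range (m + 1), (w ⬝ᵥ (B ^ (m + 1 - 1 - i) *ᵥ w)) * (w ⬝ᵥ (B ^ i *ᵥ w)) ≤
          ∑ i ∈ range (m + 1), K * (w ⬝ᵥ (B ^ m *ᵥ w)) := by
        refine sum_le_sum fun i hi => (hB.dotProduct_pow_mulVec_mul_le w _ _).trans ?_
        have e : m + 1 - 1 - i + i = m := by have := mem_range.1 hi; omega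
        rw [e]
        exact mul_le_mul_of_nonneg_right hw (hB.dotProduct_pow_mulVec_nonneg w m)
      rw [sum_const, card_range, nsmul_eq_mul] at this
      push_cast at this ⊢
      have h2 := mul_le_mul_of_nonneg_right this (Nat.cast_nonneg (α := ℝ) m.factorial)
      linarith
    -- After the index shift, the vanishing `m = 0` term on the left faces the nonnegative top term
    -- on the right.
    · simpa using mul_nonneg hK (div_nonneg (hB.dotProduct_pow_mulVec_nonneg w M)
        (Nat.cast_nonneg _))

open Matrix Finset in
theorem quadExpPoly_le_quadExpPoly_add {ι : Type*} [Fintype ι] [DecidableEq ι]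
    {R : Matrix ι ι ℝ} (hR : R.PosSemidef) (w : ι → ℝ) (M : ℕ) {s : ℝ} (hs : 0 ≤ s) :
    quadExpPoly M w R ≤ quadExpPoly M w (R + s • vecMulVec w w) := by
  have hmono : MonotoneOn (fun s : ℝ => quadExpPoly M w (R + s • vecMulVec w w)) (Set.Ici 0) := by
    refine monotoneOn_of_deriv_nonneg (convex_Ici 0)
      (fun x _ => (hasDerivAt_quadExpPoly R w M x).continuousAt.continuousWithinAt)
      (fun x _ => (hasDerivAt_quadExpPoly R w M x).differentiableAt.differentiableWithinAt)
      fun x hx => ?_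
    rw [interior_Ici, Set.mem_Ioi] at hx
    have hB := hR.add_smul_vecMulVec w hx.le
    rw [(hasDerivAt_quadExpPoly R w M x).deriv]
    exact sum_nonneg fun m _ => div_nonneg (sum_nonneg fun i _ =>
      mul_nonneg (hB.dotProduct_pow_mulVec_nonneg w _) (hB.dotProduct_pow_mulVec_nonneg w _))
      (Nat.cast_nonneg _)
  simpa using hmono (Set.mem_Ici.2 le_rfl) (Set.mem_Ici.2 hs) hs

-- Grönwall: `e^{-Ks} q(s)` is nonincreasing because `q' ≤ K q`.
open Matrix Finset in
theorem quadExpPoly_add_le {ι : Type*} [Fintype ι] [DecidableEq ι]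
    {R : Matrix ι ι ℝ} (hR : R.PosSemidef) {w : ι → ℝ} {K : ℝ} (hw : w ⬝ᵥ w ≤ K) (M : ℕ)
    {s : ℝ} (hs : 0 ≤ s) :
    quadExpPoly M w (R + s • vecMulVec w w) ≤ Real.exp (K * s) * quadExpPoly M w R := by
  have hd (x : ℝ) := ((hasDerivAt_id x).const_mul (-K)).exp.mul (hasDerivAt_quadExpPoly R w M x)
  have hanti := antitoneOn_of_deriv_nonpos (convex_Ici (0 : ℝ))
      (fun x _ => (hd x).continuousAt.continuousWithinAt)
      (fun x _ => (hd x).differentiableAt.differentiableWithinAt)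
      (fun x hx => by
        rw [interior_Ici, Set.mem_Ioi] at hx
        rw [(hd x).deriv]
        have := mul_le_mul_of_nonneg_left
          (sum_moment_convolution_le (hR.add_smul_vecMulVec w hx.le) hw M)
          (Real.exp_nonneg (-K * id x))
        linarith)
  have h := hanti (Set.mem_Ici.2 le_rfl) (Set.mem_Ici.2 hs) hs
  simp only [Pi.mul_apply, id, mul_zero, Real.exp_zero, one_mul, zero_smul, add_zero] at h
  calc quadExpPoly M w (R + s • vecMulVec w w)
      = Real.exp (K * s) * (Real.exp (-K * s) * quadExpPoly M w (R + s • vecMulVec w w)) := by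
        rw [← mul_assoc, ← Real.exp_add]; simp
    _ ≤ _ := mul_le_mul_of_nonneg_left h (Real.exp_nonneg _)

-- The bound `q(s) ≤ e^{Ks} q(0)`, integrated from `0` to `s`.
open Matrix Finset in
theorem traceExpPoly_add_le {ι : Type*} [Fintype ι] [DecidableEq ι]
    {R : Matrix ι ι ℝ} (hR : R.PosSemidef) {w : ι → ℝ} {K : ℝ} (hK : 0 < K) (hw : w ⬝ᵥ w ≤ K)
    (M : ℕ) {s : ℝ} (hs : 0 ≤ s) :
    traceExpPoly (M + 1) (R + s • vecMulVec w w) ≤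
      traceExpPoly (M + 1) R + (Real.exp (K * s) - 1) / K * quadExpPoly M w R := by
  have hd (x : ℝ) := (hasDerivAt_traceExpPoly R w M x).sub
    ((((hasDerivAt_id x).const_mul K).exp.div_const K).mul_const (quadExpPoly M w R))
  have hanti := antitoneOn_of_deriv_nonpos (convex_Ici (0 : ℝ))
      (fun x _ => (hd x).continuousAt.continuousWithinAt)
      (fun x _ => (hd x).differentiableAt.differentiableWithinAt)
      (fun x hx => by
        rw [interior_Ici, Set.mem_Ioi] at hx
        rw [(hd x).deriv, mul_one, mul_div_cancel_right₀ _ hK.ne', sub_nonpos]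
        exact quadExpPoly_add_le hR hw M hx.le)
  have h := hanti (Set.mem_Ici.2 le_rfl) (Set.mem_Ici.2 hs) hs
  simp only [Pi.sub_apply, id, mul_zero, Real.exp_zero, zero_smul, add_zero] at h
  rw [sub_div, sub_mul]
  linarith

-- Since `q` is nondecreasing, the function lies above its tangent at `0`.
open Matrix Finset in
theorem traceExpPoly_add_mul_quadExpPoly_le {ι : Type*} [Fintype ι] [DecidableEq ι]
    {R : Matrix ι ι ℝ} (hR : R.PosSemidef) (w : ι → ℝ) (M : ℕ) {s : ℝ} (hs : 0 ≤ s) :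
    traceExpPoly (M + 1) R + s * quadExpPoly M w R ≤
      traceExpPoly (M + 1) (R + s • vecMulVec w w) := by
  have hd (x : ℝ) := (hasDerivAt_traceExpPoly R w M x).sub
    ((hasDerivAt_id x).mul_const (quadExpPoly M w R))
  have hmono := monotoneOn_of_deriv_nonneg (convex_Ici (0 : ℝ))
      (fun x _ => (hd x).continuousAt.continuousWithinAt)
      (fun x _ => (hd x).differentiableAt.differentiableWithinAt)
      (fun x hx => by
        rw [interior_Ici, Set.mem_Ioi] at hx
        rw [(hd x).deriv, one_mul, sub_nonneg]
        exact quadExpPoly_le_quadExpPoly_add hR w M hx.le)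
  have h := hmono (Set.mem_Ici.2 le_rfl) (Set.mem_Ici.2 hs) hs
  simp only [Pi.sub_apply, id, zero_mul, zero_smul, add_zero] at h
  linarith

/-! ### Averaging over the random set and the Chernoff bound -/

open Matrix Finset in
/-- Replacing a Bernoulli multiple of a rank one matrix by a suitable constant multiple does not
decrease the expected truncated trace exponential. -/
theorem bernoulli_traceExpPoly_le {ι : Type*} [Fintype ι] [DecidableEq ι]
    {R : Matrix ι ι ℝ} (hR : R.PosSemidef) {w : ι → ℝ} {K : ℝ} (hK : 0 < K) (hw : w ⬝ᵥ w ≤ K)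
    (M : ℕ) {θ ρ : ℝ} (hθ : 0 ≤ θ) (hρ : 0 ≤ ρ) :
    (1 - ρ) * traceExpPoly (M + 1) R + ρ * traceExpPoly (M + 1) (R + θ • vecMulVec w w) ≤
      traceExpPoly (M + 1) (R + (ρ * ((Real.exp (K * θ) - 1) / K)) • vecMulVec w w) := by
  have hκ : 0 ≤ (Real.exp (K * θ) - 1) / K :=
    div_nonneg (sub_nonneg.2 (Real.one_le_exp (by positivity))) hK.le
  have h1 := mul_le_mul_of_nonneg_left (traceExpPoly_add_le hR hK hw M hθ) hρ
  have h2 := traceExpPoly_add_mul_quadExpPoly_le hR w M (mul_nonneg hρ hκ)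
  linarith

-- Induction on `T`: with the other choices `A` fixed, the new entry is averaged out first, and its
-- constant increment is absorbed into `R`. Hence `R` is universally quantified.
open Matrix Finset in
theorem sum_powerset_traceExpPoly_le {ι κ : Type*} [Fintype ι] [DecidableEq ι] [DecidableEq κ]
    (w : κ → ι → ℝ) {K : ℝ} (hK : 0 < K) (hw : ∀ p, w p ⬝ᵥ w p ≤ K) (M : ℕ) {θ ρ : ℝ}
    (hθ : 0 ≤ θ) (hρ : 0 ≤ ρ) (hρ' : ρ ≤ 1) (T : Finset κ) :
    ∀ R : Matrix ι ι ℝ, R.PosSemidef →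
    ∑ A ∈ T.powerset, ρ ^ #A * (1 - ρ) ^ #(T \ A) *
        traceExpPoly (M + 1) (R + θ • ∑ p ∈ A, vecMulVec (w p) (w p)) ≤
      traceExpPoly (M + 1)
        (R + (ρ * ((Real.exp (K * θ) - 1) / K)) • ∑ p ∈ T, vecMulVec (w p) (w p)) := by
  have hκ : 0 ≤ ρ * ((Real.exp (K * θ) - 1) / K) :=
    mul_nonneg hρ (div_nonneg (sub_nonneg.2 (Real.one_le_exp (by positivity))) hK.le)
  induction T using Finset.induction_on with
  | empty => intro R _; simp
  | insert q T hq ih =>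
    intro R hR
    rw [sum_powerset_insert hq, ← sum_add_distrib, sum_insert hq, smul_add, ← add_assoc]
    refine le_trans (sum_le_sum fun A hA => ?_) (ih _ (hR.add_smul_vecMulVec (w q) hκ))
    have hA' := mem_powerset.1 hA
    have hqA : q ∉ A := fun h => hq (hA' h)
    have hpsd : (R + θ • ∑ p ∈ A, vecMulVec (w p) (w p)).PosSemidef :=
      hR.add (PosSemidef.smul (posSemidef_sum _ fun p _ => by
        simpa using posSemidef_vecMulVec_self_star (w p)) hθ)
    have h := mul_le_mul_of_nonneg_left (bernoulli_traceExpPoly_le hpsd hK (hw q) M hθ hρ)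
      (mul_nonneg (pow_nonneg hρ #A) (pow_nonneg (sub_nonneg.2 hρ') #(T \ A)))
    have c1 : #(insert q T \ A) = #(T \ A) + 1 := by
      rw [insert_sdiff_of_notMem _ hqA, card_insert_of_notMem (by simp [hq])]
    have c2 : insert q T \ insert q A = T \ A := by
      rw [insert_sdiff_insert, sdiff_insert_of_notMem hq]
    rw [c1, c2, card_insert_of_notMem hqA, sum_insert hqA, smul_add]
    convert h using 1
    · rw [show R + (θ • vecMulVec (w q) (w q) + θ • ∑ p ∈ A, vecMulVec (w p) (w p)) =
        R + θ • ∑ p ∈ A, vecMulVec (w p) (w p) + θ • vecMulVec (w q) (w q) by abel]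
      ring
    · rw [add_right_comm]

open Matrix Finset in
/-- Upper tail bound for the largest eigenvalue of a Bernoulli selection of the columns of an
orthogonal projection matrix. -/
theorem sum_weights_le_of_large_quadForm {ι : Type*} [Fintype ι] [DecidableEq ι]
    {Q : Matrix ι ι ℝ} (hsymm : Qᵀ = Q) (hidem : Q * Q = Q) {K : ℝ} (hK : 0 < K)
    (hQK : ∀ p, Q p p ≤ K) {θ ρ t : ℝ} (hθ : 0 ≤ θ) (hρ : 0 ≤ ρ) (hρ' : ρ ≤ 1) (ht : 0 ≤ t)
    (𝓑 : Finset (Finset ι))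
    (h𝓑 : ∀ A ∈ 𝓑, ∃ x : ι → ℝ, 0 < x ⬝ᵥ x ∧ t * (x ⬝ᵥ x) ≤ ∑ p ∈ A, (Q *ᵥ x) p ^ 2) :
    ∑ A ∈ 𝓑, ρ ^ #A * (1 - ρ) ^ #(univ \ A) ≤
      Fintype.card ι * Real.exp (ρ * ((Real.exp (K * θ) - 1) / K) - θ * t) := by
  set κ := ρ * ((Real.exp (K * θ) - 1) / K) with hκdef
  have hκ : 0 ≤ κ :=
    mul_nonneg hρ (div_nonneg (sub_nonneg.2 (Real.one_le_exp (by positivity))) hK.le)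
  have hwt (A : Finset ι) : 0 ≤ ρ ^ #A * (1 - ρ) ^ #(univ \ A) :=
    mul_nonneg (pow_nonneg hρ _) (pow_nonneg (sub_nonneg.2 hρ') _)
  have hQQ (p : ι) : Q p ⬝ᵥ Q p = Q p p := by
    conv_rhs => rw [← hidem]
    rw [mul_apply]
    refine sum_congr rfl fun k _ => ?_
    rw [← transpose_apply Q p k, hsymm]
  have hw (p : ι) : Q p ⬝ᵥ Q p ≤ K := (hQQ p).le.trans (hQK p)
  have hsum : ∑ p, vecMulVec (Q p) (Q p) = Q := by
    conv_rhs => rw [← hidem]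
    ext i j
    rw [Matrix.sum_apply, mul_apply]
    refine sum_congr rfl fun k _ => ?_
    rw [vecMulVec_apply, ← transpose_apply Q i k, hsymm]
  have htrace : Q.trace ≤ Fintype.card ι := by
    have h1 (p : ι) : Q p p ≤ 1 := by
      have h2 : Q p p ^ 2 ≤ Q p p := by
        conv_rhs => rw [← hQQ p]
        rw [dotProduct]
        simpa [sq] using single_le_sum (f := fun k => Q p k * Q p k)
          (fun k _ => mul_self_nonneg _) (mem_univ p)
      nlinarith
    calc Q.trace ≤ ∑ _p : ι, (1 : ℝ) := sum_le_sum fun p _ => h1 p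
      _ = _ := by simp
  -- All positive powers of `Q` equal `Q`, so every power has trace at most the dimension.
  have hpoly (M : ℕ) : traceExpPoly M (κ • Q) ≤ Fintype.card ι * Real.exp κ := by
    refine le_trans ?_ (mul_le_mul_of_nonneg_left (Real.sum_le_exp_of_nonneg hκ M)
      (Nat.cast_nonneg _))
    rw [mul_sum]
    refine sum_le_sum fun m _ => ?_
    rw [smul_pow, trace_smul, smul_eq_mul, ← mul_div_assoc, mul_comm (Fintype.card ι : ℝ)]
    refine div_le_div_of_nonneg_right (mul_le_mul_of_nonneg_left ?_ (pow_nonneg hκ m))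
      (Nat.cast_nonneg _)
    cases m with
    | zero => simp
    | succ m => rwa [IsIdempotentElem.pow_succ_eq m hidem]
  have hpsd (A : Finset ι) : (θ • ∑ p ∈ A, vecMulVec (Q p) (Q p)).PosSemidef :=
    PosSemidef.smul (posSemidef_sum _ fun p _ => by
        simpa using posSemidef_vecMulVec_self_star (Q p)) hθ
  have hlow (M : ℕ) {A : Finset ι} (hA : A ∈ 𝓑) :
      ∑ m ∈ range M, (θ * t) ^ m / (m.factorial : ℝ) ≤
        traceExpPoly M (θ • ∑ p ∈ A, vecMulVec (Q p) (Q p)) := by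
    obtain ⟨x, hx, hxt⟩ := h𝓑 A hA
    refine sum_le_sum fun m _ => div_le_div_of_nonneg_right ?_ (Nat.cast_nonneg _)
    refine (hpsd A).pow_le_trace_pow (mul_nonneg hθ ht) hx ?_ m
    rw [smul_mulVec, dotProduct_smul, smul_eq_mul, mul_assoc, sum_mulVec, dotProduct_sum]
    refine mul_le_mul_of_nonneg_left (hxt.trans_eq (sum_congr rfl fun p _ => ?_)) hθ
    rw [vecMulVec_mulVec, dotProduct_smul, mulVec]
    simp [sq, dotProduct_comm x]
  -- Markov's inequality at truncation level `M + 1`; both the truncated exponential and the weights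
  -- are nonnegative, so subsets outside `𝓑` can be added.
  have hM (M : ℕ) : (∑ A ∈ 𝓑, ρ ^ #A * (1 - ρ) ^ #(univ \ A)) *
      ∑ m ∈ range (M + 1), (θ * t) ^ m / (m.factorial : ℝ) ≤ Fintype.card ι * Real.exp κ := by
    have h := sum_powerset_traceExpPoly_le (fun p => Q p) hK hw M hθ hρ hρ' univ 0 PosSemidef.zero
    simp only [zero_add, hsum, ← hκdef] at h
    refine le_trans ?_ (h.trans (hpoly _))
    rw [sum_mul]
    refine (sum_le_sum fun A hA => mul_le_mul_of_nonneg_left (hlow (M + 1) hA) (hwt A)).trans ?_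
    exact sum_le_sum_of_subset_of_nonneg (fun A _ => by simp)
      fun A _ _ => mul_nonneg (hwt A) (traceExpPoly_nonneg (hpsd A) _)
  have hlim : (∑ A ∈ 𝓑, ρ ^ #A * (1 - ρ) ^ #(univ \ A)) * Real.exp (θ * t) ≤
      Fintype.card ι * Real.exp κ := by
    have hs : HasSum (fun m : ℕ => (θ * t) ^ m / (m.factorial : ℝ)) (Real.exp (θ * t)) := by
      rw [Real.exp_eq_exp_ℝ]
      exact NormedSpace.expSeries_div_hasSum_exp (θ * t)
    have h := hs.tendsto_sum_nat.comp (Filter.tendsto_add_atTop_nat 1)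
    exact le_of_tendsto (h.const_mul _) (Filter.Eventually.of_forall hM)
  rw [Real.exp_sub, ← mul_div_assoc, le_div_iff₀ (Real.exp_pos _)]
  exact hlim

/-! ### The two projections in coordinates -/

theorem starProjection_supportedOn_apply {n₁ n₂ : ℕ} (S : Set (Fin n₁ × Fin n₂))
    [DecidablePred (· ∈ S)] (z : MatSpace n₁ n₂) (p : Fin n₁ × Fin n₂) :
    (supportedOn S).starProjection z p = if p ∈ S then z p else 0 := by
  have h : (supportedOn S).starProjection z = WithLp.toLp 2 fun p => if p ∈ S then z p else 0 := by
    have hmem : (WithLp.toLp 2 fun p => if p ∈ S then z p else 0) ∈ supportedOn S :=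
      fun p hp => if_neg hp
    refine Submodule.eq_starProjection_of_mem_of_inner_eq_zero hmem fun y hy => ?_
    rw [PiLp.inner_apply]
    refine Finset.sum_eq_zero fun p _ => ?_
    by_cases hp : p ∈ S
    · simp [hp]
    · simp [hy p hp]
  rw [h]

open Classical in
theorem norm_projSupportTangent_apply_sq {n₁ n₂ r : ℕ} (S : Set (Fin n₁ × Fin n₂))
    (U : Matrix (Fin n₁) (Fin r) ℝ) (V : Matrix (Fin n₂) (Fin r) ℝ) (x : MatSpace n₁ n₂) :
    ‖projSupportTangent S U V x‖ ^ 2 =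
      ∑ p ∈ S.toFinset, (tangentSpace U V).starProjection x p ^ 2 := by
  rw [EuclideanSpace.norm_sq_eq, ← Finset.sum_filter_add_sum_filter_not Finset.univ (· ∈ S)]
  simp only [projSupportTangent, ContinuousLinearMap.comp_apply, starProjection_supportedOn_apply,
    Real.norm_eq_abs, sq_abs]
  rw [Finset.sum_congr (s₂ := S.toFinset) (by ext; simp)
    (g := fun p => (tangentSpace U V).starProjection x p ^ 2) (fun p hp => by
      simp [Set.mem_toFinset.1 hp]), Finset.sum_eq_zero (s := Finset.filter (· ∉ S) _)
    (fun p hp => by simp [(Finset.mem_filter.1 hp).2]), add_zero]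

theorem norm_projSupportTangent_le_one {n₁ n₂ r : ℕ} (S : Set (Fin n₁ × Fin n₂))
    (U : Matrix (Fin n₁) (Fin r) ℝ) (V : Matrix (Fin n₂) (Fin r) ℝ) :
    ‖projSupportTangent S U V‖ ≤ 1 := by
  refine (ContinuousLinearMap.opNorm_comp_le _ _).trans ?_
  exact mul_le_one₀ (Submodule.starProjection_norm_le _) (norm_nonneg _)
    (Submodule.starProjection_norm_le _)

open Matrix in
/-- The diagonal entries of the projection onto the tangent space, in terms of the projections
`U Uᵀ` and `V Vᵀ`. -/
theorem starProjection_tangentSpace_single_apply {n₁ n₂ r : ℕ} {U : Matrix (Fin n₁) (Fin r) ℝ}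
    {V : Matrix (Fin n₂) (Fin r) ℝ} (hU : Uᵀ * U = 1) (hV : Vᵀ * V = 1) (i : Fin n₁)
    (j : Fin n₂) :
    (tangentSpace U V).starProjection (EuclideanSpace.single (i, j) 1) (i, j) =
      (U * Uᵀ) i i + (V * Vᵀ) j j - (U * Uᵀ) i i * (V * Vᵀ) j j := by
  set E : Matrix (Fin n₁) (Fin n₂) ℝ := Matrix.single i j 1 with hE
  -- The usual formula `UUᵀE + EVVᵀ - UUᵀEVVᵀ` for `P_T E`, grouped so that membership in `T` is
  -- visible.
  set C : Matrix (Fin n₁) (Fin n₂) ℝ := U * (Uᵀ * E) + (E * V - U * (Uᵀ * E * V)) * Vᵀ with hC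
  have hperp : E - C = (1 - U * Uᵀ) * E * (1 - V * Vᵀ) := by
    rw [hC]
    simp only [Matrix.sub_mul, Matrix.mul_sub, Matrix.one_mul, Matrix.mul_one, Matrix.mul_assoc]
    abel
  have hleft : Uᵀ * (E - C) = 0 := by
    have h0 : Uᵀ * (1 - U * Uᵀ) = 0 := by
      rw [Matrix.mul_sub, Matrix.mul_one, ← Matrix.mul_assoc, hU, Matrix.one_mul, sub_self]
    rw [hperp, ← Matrix.mul_assoc, ← Matrix.mul_assoc, h0, Matrix.zero_mul, Matrix.zero_mul]
  have hright : (E - C) * V = 0 := by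
    have h0 : (1 - V * Vᵀ) * V = 0 := by
      rw [Matrix.sub_mul, Matrix.one_mul, Matrix.mul_assoc, hV, Matrix.mul_one, sub_self]
    rw [hperp, Matrix.mul_assoc, h0, Matrix.mul_zero]
  have h : (tangentSpace U V).starProjection (EuclideanSpace.single (i, j) 1) =
      WithLp.toLp 2 fun p => C p.1 p.2 := by
    have hmem : (WithLp.toLp 2 fun p => C p.1 p.2) ∈ tangentSpace U V :=
      ⟨(Uᵀ * E)ᵀ, E * V - U * (Uᵀ * E * V), fun a b => by rw [transpose_transpose]⟩
    refine Submodule.eq_starProjection_of_mem_of_inner_eq_zero hmem ?_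
    rintro Z ⟨X, Y, hZ⟩
    have h1 : inner ℝ (EuclideanSpace.single (i, j) (1 : ℝ) - WithLp.toLp 2 fun p => C p.1 p.2) Z =
        ((E - C)ᵀ * (U * Xᵀ + Y * Vᵀ)).trace := by
      rw [PiLp.inner_apply, Fintype.sum_prod_type_right, Matrix.trace]
      refine Finset.sum_congr rfl fun b _ => ?_
      rw [diag_apply, mul_apply]
      refine Finset.sum_congr rfl fun a _ => ?_
      rw [hZ a b]
      have : E a b = if a = i ∧ b = j then 1 else 0 := by
        rw [hE, Matrix.single_apply]
        simp only [eq_comm]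
      simp [this, mul_comm]
    have h2 : (E - C)ᵀ * U = 0 := by
      rw [← transpose_transpose U, ← transpose_mul, hleft, transpose_zero]
    have h3 : Vᵀ * (E - C)ᵀ = 0 := by
      rw [← transpose_mul, hright, transpose_zero]
    rw [h1, Matrix.mul_add, ← Matrix.mul_assoc, h2, Matrix.zero_mul, zero_add, trace_mul_comm,
      Matrix.mul_assoc, h3, Matrix.mul_zero, trace_zero]
  have hl : (U * (Uᵀ * E)) i j = (U * Uᵀ) i i := by
    rw [← Matrix.mul_assoc, hE]; simp
  have hr : (E * V * Vᵀ) i j = (V * Vᵀ) j j := by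
    rw [Matrix.mul_assoc, hE]; simp
  have hlr : (U * (Uᵀ * E * V) * Vᵀ) i j = (U * Uᵀ) i i * (V * Vᵀ) j j := by
    rw [show U * (Uᵀ * E * V) * Vᵀ = U * Uᵀ * (E * (V * Vᵀ)) by simp only [Matrix.mul_assoc],
      mul_apply, Finset.sum_eq_single i]
    · rw [hE]; simp
    · intro b _ hb
      rw [hE, Matrix.single_mul_apply_of_ne _ _ _ _ _ hb, mul_zero]
    · simp
  rw [h]
  change C i j = _
  rw [hC, Matrix.sub_mul, Matrix.add_apply, Matrix.sub_apply, hl, hr, hlr]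
  ring

open Matrix in
theorem IsIncoherent.starProjection_single_apply_le {n₁ n₂ r : ℕ}
    {U : Matrix (Fin n₁) (Fin r) ℝ} {V : Matrix (Fin n₂) (Fin r) ℝ} {μ : ℝ}
    (h : IsIncoherent U V μ) (hU : Uᵀ * U = 1) (hV : Vᵀ * V = 1) (p : Fin n₁ × Fin n₂) :
    (tangentSpace U V).starProjection (EuclideanSpace.single p 1) p ≤
      2 * (μ * r / (min n₁ n₂ : ℕ)) := by
  obtain ⟨i, j⟩ := p
  have hu : (U * Uᵀ) i i = ∑ k, U i k ^ 2 := by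
    simp only [mul_apply, transpose_apply, sq]
  have hv : (V * Vᵀ) j j = ∑ k, V j k ^ 2 := by
    simp only [mul_apply, transpose_apply, sq]
  have hu0 : 0 ≤ ∑ k, U i k ^ 2 := Finset.sum_nonneg fun k _ => sq_nonneg _
  have hv0 : 0 ≤ ∑ k, V j k ^ 2 := Finset.sum_nonneg fun k _ => sq_nonneg _
  have hn₁ : (0 : ℝ) < n₁ := Nat.cast_pos.2 i.pos
  have hn₂ : (0 : ℝ) < n₂ := Nat.cast_pos.2 j.pos
  have hmin : (0 : ℝ) < (min n₁ n₂ : ℕ) := Nat.cast_pos.2 (lt_min i.pos j.pos)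
  have hμ : 0 ≤ μ * r := by
    have := hu0.trans (h.left i)
    rwa [le_div_iff₀ hn₁, zero_mul] at this
  have h1 : μ * r / n₁ ≤ μ * r / (min n₁ n₂ : ℕ) :=
    div_le_div_of_nonneg_left hμ hmin (Nat.cast_le.2 (min_le_left _ _))
  have h2 : μ * r / n₂ ≤ μ * r / (min n₁ n₂ : ℕ) :=
    div_le_div_of_nonneg_left hμ hmin (Nat.cast_le.2 (min_le_right _ _))
  rw [starProjection_tangentSpace_single_apply hU hV, hu, hv]
  have := mul_nonneg hu0 hv0
  linarith [h.left i, h.right j]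

/-! ### Tail bound and choice of constants -/

open Matrix Classical in
theorem setBernoulli_real_norm_projSupportTangent_le {n₁ n₂ r : ℕ}
    (U : Matrix (Fin n₁) (Fin r) ℝ) (V : Matrix (Fin n₂) (Fin r) ℝ) {K : ℝ} (hK : 0 < K)
    (hd : ∀ p, (tangentSpace U V).starProjection (EuclideanSpace.single p 1) p ≤ K)
    (ρ : unitInterval) {ε : ℝ} (hε : 0 < ε) (hε' : ε ≤ 1) :
    (setBernoulli Set.univ ρ).real {S | ‖projSupportTangent S U V‖ ^ 2 ≤ (ρ : ℝ) + ε}ᶜ ≤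
      (n₁ * n₂ : ℕ) * Real.exp (-(ε ^ 2 / (4 * K))) := by
  set T := tangentSpace U V
  set Q : Matrix (Fin n₁ × Fin n₂) (Fin n₁ × Fin n₂) ℝ :=
    (toEuclideanCLM (n := Fin n₁ × Fin n₂) (𝕜 := ℝ)).symm T.starProjection with hQ
  have hQT : toEuclideanCLM (n := Fin n₁ × Fin n₂) (𝕜 := ℝ) Q = T.starProjection := by simp [hQ]
  have happly (x : MatSpace n₁ n₂) (p) : (Q *ᵥ x) p = T.starProjection x p := by
    rw [← hQT]; rfl
  have hsymm : Qᵀ = Q := by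
    have : star Q = Q := EquivLike.injective (toEuclideanCLM (n := Fin n₁ × Fin n₂) (𝕜 := ℝ)) (by
      rw [map_star, hQT, (isSelfAdjoint_starProjection T).star_eq])
    simpa [Matrix.star_eq_conjTranspose] using this
  have hidem : Q * Q = Q := by
    rw [hQ, ← map_mul, (T.isIdempotentElem_starProjection).eq]
  have hdiag (p) : Q p p ≤ K := by
    refine le_trans (le_of_eq ?_) (hd p)
    rw [← happly]
    simp
  have hρ := ρ.2.1
  have hρ' := ρ.2.2
  set 𝓑 : Finset (Finset (Fin n₁ × Fin n₂)) := Finset.univ.filter fun A =>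
    ¬ ‖projSupportTangent (A : Set (Fin n₁ × Fin n₂)) U V‖ ^ 2 ≤ (ρ : ℝ) + ε with h𝓑
  have hset : {S | ‖projSupportTangent S U V‖ ^ 2 ≤ (ρ : ℝ) + ε}ᶜ =
      ((𝓑.image fun A : Finset (Fin n₁ × Fin n₂) => (A : Set (Fin n₁ × Fin n₂)) :
        Finset (Set (Fin n₁ × Fin n₂))) :
        Set (Set (Fin n₁ × Fin n₂))) := by
    ext S
    simp only [Set.mem_compl_iff, Set.mem_ofPred_eq, Finset.coe_image, Set.mem_image,
      Finset.mem_coe, h𝓑, Finset.mem_filter, Finset.mem_univ, true_and]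
    constructor
    · intro h
      exact ⟨S.toFinset, by simpa using h, by simp⟩
    · rintro ⟨A, hA, rfl⟩
      exact hA
  rw [hset, ← sum_measureReal_singleton, Finset.sum_image (Finset.coe_injective.injOn)]
  have hbad : ∀ A ∈ 𝓑, ∃ x : Fin n₁ × Fin n₂ → ℝ, 0 < x ⬝ᵥ x ∧
      ((ρ : ℝ) + ε) * (x ⬝ᵥ x) ≤ ∑ p ∈ A, (Q *ᵥ x) p ^ 2 := by
    intro A hA
    by_contra! hcon
    refine (Finset.mem_filter.1 hA).2 ?_
    have hb : ‖projSupportTangent (A : Set (Fin n₁ × Fin n₂)) U V‖ ≤ √((ρ : ℝ) + ε) := by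
      refine ContinuousLinearMap.opNorm_le_bound _ (Real.sqrt_nonneg _) fun x => ?_
      refine (sq_le_sq₀ (norm_nonneg _) (by positivity)).1 ?_
      rw [mul_pow, Real.sq_sqrt (by positivity), norm_projSupportTangent_apply_sq]
      have hx : ‖x‖ ^ 2 = (x : Fin n₁ × Fin n₂ → ℝ) ⬝ᵥ x := by
        rw [EuclideanSpace.norm_sq_eq, dotProduct]
        simp [sq]
      rcases (norm_nonneg x).eq_or_lt with h0 | h0
      · rw [norm_eq_zero.1 h0.symm]; simp
      · have := hcon x (by rw [← hx]; positivity)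
        rw [hx]
        simp only [happly] at this
        simpa using this.le
    calc _ ≤ √((ρ : ℝ) + ε) ^ 2 := pow_le_pow_left₀ (norm_nonneg _) hb 2
      _ = _ := Real.sq_sqrt (by positivity)
  -- With `θ = ε / (2K)` one has `Kθ = ε / 2 ≤ 1`, so `e^x - 1 ≤ x + x²` applies at `x = Kθ`. Then
  -- `K` times the exponent is at most `ρ ε² / 4 - ε² / 2 ≤ -ε² / 4`.
  have hθ : 0 ≤ ε / (2 * K) := by positivity
  have htail := sum_weights_le_of_large_quadForm hsymm hidem hK hdiag hθ hρ hρ'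
    (by positivity) 𝓑 hbad
  have hwt (A : Finset (Fin n₁ × Fin n₂)) :
      (setBernoulli Set.univ ρ).real {(A : Set (Fin n₁ × Fin n₂))} =
        (ρ : ℝ) ^ A.card * (1 - (ρ : ℝ)) ^ (Finset.univ \ A).card := by
    rw [setBernoulli_real_singleton ρ (Set.subset_univ _) Set.finite_univ, Set.ncard_coe_finset,
      ← Finset.coe_univ, ← Finset.coe_sdiff, Set.ncard_coe_finset]
  simp only [hwt]
  refine htail.trans ?_
  rw [Fintype.card_prod, Fintype.card_fin, Fintype.card_fin]
  refine mul_le_mul_of_nonneg_left (Real.exp_le_exp.2 ?_) (Nat.cast_nonneg _)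
  have e1 : K * (ε / (2 * K)) = ε / 2 := by field_simp
  have hexp : Real.exp (ε / 2) - 1 ≤ ε / 2 + (ε / 2) ^ 2 := by
    have := Real.abs_exp_sub_one_sub_id_le (x := ε / 2) (by rw [abs_of_pos] <;> linarith)
    linarith [le_abs_self (Real.exp (ε / 2) - 1 - ε / 2)]
  rw [e1]
  have e2 : -(ε ^ 2 / (4 * K)) = (ε / 2 + (ε / 2) ^ 2 - ε / 2 * (1 + ε)) / K := by
    field_simp; ring
  have e3 : (ρ : ℝ) * ((Real.exp (ε / 2) - 1) / K) - ε / (2 * K) * (ρ + ε) =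
      (ρ * (Real.exp (ε / 2) - 1) - ε / 2 * (ρ + ε)) / K := by
    field_simp
  rw [e2, e3]
  refine div_le_div_of_nonneg_right ?_ hK.le
  have h1 := mul_le_mul_of_nonneg_left hexp hρ
  have h2 := mul_le_mul_of_nonneg_right hρ' (sq_nonneg (ε / 2))
  linarith

theorem mainTheorem10 :
    ∃ C₀ : ℝ, 0 < C₀ ∧ ∃ c : ℝ, 0 < c ∧
      ∀ (n₁ n₂ r : ℕ), 0 < n₁ → 0 < n₂ →
      ∀ (L₀ : Matrix (Fin n₁) (Fin n₂) ℝ) (U : Matrix (Fin n₁) (Fin r) ℝ) (σ : Fin r → ℝ)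
        (V : Matrix (Fin n₂) (Fin r) ℝ) (μ : ℝ),
        IsReducedSVD L₀ U σ V → IsIncoherent U V μ →
      ∀ (ρ : unitInterval) (ε : ℝ), 0 < ε →
        C₀ * (ε ^ 2)⁻¹ * (μ * r * Real.log (max n₁ n₂ : ℕ) / (min n₁ n₂ : ℕ)) ≤ 1 - (ρ : ℝ) →
      ∀ {α : Type*} [MeasurableSpace α] (P : Measure α) (Ω : α → Set (Fin n₁ × Fin n₂)),
        IsSetBernoulli Ω Set.univ ρ P →
        1 - c * ((max n₁ n₂ : ℕ) : ℝ) ^ (-10 : ℤ) ≤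
          P.real {a | ‖projSupportTangent (Ω a) U V‖ ^ 2 ≤ (ρ : ℝ) + ε} := by
  -- `96 = 2 · 4 · 12`: the `2` comes from `K = 2k`, the `4` from the exponent `ε² / (4K)`, and the
  -- power `12` pays for the target `10` plus the dimension `n₁ n₂ ≤ n₍₁₎²`.
  refine ⟨96, by norm_num, 1, one_pos, ?_⟩
  intro n₁ n₂ r hn₁ hn₂ L₀ U σ V μ hsvd hinc ρ ε hε hcond α _ P Ω hΩ
  set good : Set (Set (Fin n₁ × Fin n₂)) := {S | ‖projSupportTangent S U V‖ ^ 2 ≤ (ρ : ℝ) + ε}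
  have hmeas : MeasurableSet good := good.toFinite.measurableSet
  have hlaw : P.real {a | ‖projSupportTangent (Ω a) U V‖ ^ 2 ≤ (ρ : ℝ) + ε} =
      (setBernoulli Set.univ ρ).real good := by
    rw [← hΩ.map_eq, measureReal_def, measureReal_def,
      Measure.map_apply_of_aemeasurable hΩ.aemeasurable hmeas]
    rfl
  rw [hlaw, ← sub_sub_cancel 1 ((setBernoulli Set.univ ρ).real good),
    ← probReal_compl_eq_one_sub hmeas, one_mul]
  refine sub_le_sub_left ?_ 1
  have hn : (0 : ℝ) < (max n₁ n₂ : ℕ) := Nat.cast_pos.2 (lt_max_of_lt_left hn₁)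
  have hpow : (0 : ℝ) ≤ ((max n₁ n₂ : ℕ) : ℝ) ^ (-10 : ℤ) := (zpow_pos hn _).le
  set k : ℝ := μ * r / (min n₁ n₂ : ℕ) with hk
  set l : ℝ := Real.log (max n₁ n₂ : ℕ) with hl
  have hρ := ρ.2.1
  -- For `ε > 1` the bound is deterministic, since a product of two projections has norm at most
  -- `1`.
  rcases lt_or_ge 1 ε with hε1 | hε1
  · have : goodᶜ = ∅ := by
      rw [Set.compl_empty_iff]
      refine Set.eq_univ_of_forall fun S => ?_
      have := pow_le_one₀ (norm_nonneg _) (norm_projSupportTangent_le_one S U V) (n := 2)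
      exact this.trans (by linarith)
    rw [this, measureReal_empty]
    exact hpow
  have hdiag := hinc.starProjection_single_apply_le hsvd.orthonormal_left hsvd.orthonormal_right
  have hl0 : 0 ≤ l := Real.log_natCast_nonneg _
  have hkl : 96 * (k * l) ≤ ε ^ 2 := by
    have h1 : 96 * (ε ^ 2)⁻¹ * (k * l) ≤ 1 := by
      refine le_trans (le_of_eq ?_) (hcond.trans (by linarith))
      rw [hk]; ring
    have h2 := mul_le_mul_of_nonneg_left h1 (sq_nonneg ε)
    have h3 : ε ^ 2 * (96 * (ε ^ 2)⁻¹ * (k * l)) = 96 * (k * l) := by field_simp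
    linarith
  -- If `k = 0`, any small positive constant serves as the coherence bound.
  obtain ⟨K, hK, hkK, hKl⟩ : ∃ K : ℝ, 0 < K ∧ 2 * k ≤ K ∧ 48 * (K * l) ≤ ε ^ 2 := by
    rcases lt_or_ge 0 k with h | h
    · exact ⟨2 * k, by linarith, le_rfl, by linarith⟩
    · refine ⟨ε ^ 2 / (48 * (l + 1)), by positivity, ?_, ?_⟩
      · have : 0 < ε ^ 2 / (48 * (l + 1)) := by positivity
        linarith
      · have : 48 * (ε ^ 2 / (48 * (l + 1)) * l) = ε ^ 2 * (l / (l + 1)) := by field_simp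
        rw [this]
        exact mul_le_of_le_one_right (sq_nonneg ε) ((div_le_one (by linarith)).2 (by linarith))
  refine (setBernoulli_real_norm_projSupportTangent_le U V hK (fun p => (hdiag p).trans hkK) ρ hε
    hε1).trans ?_
  have hexp : Real.exp (-(ε ^ 2 / (4 * K))) ≤ ((max n₁ n₂ : ℕ) : ℝ) ^ (-12 : ℤ) := by
    have : ((max n₁ n₂ : ℕ) : ℝ) ^ (-12 : ℤ) = Real.exp (-(12 * l)) := by
      rw [← Real.rpow_intCast, Real.rpow_def_of_pos hn, ← hl]
      congr 1
      push_cast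
      ring
    rw [this, Real.exp_le_exp, neg_le_neg_iff, le_div_iff₀ (by positivity)]
    linarith
  have hcard : ((n₁ * n₂ : ℕ) : ℝ) ≤ ((max n₁ n₂ : ℕ) : ℝ) ^ (2 : ℤ) := by
    have : n₁ * n₂ ≤ max n₁ n₂ ^ 2 := by
      rw [sq]; exact Nat.mul_le_mul (le_max_left _ _) (le_max_right _ _)
    exact_mod_cast this
  calc ((n₁ * n₂ : ℕ) : ℝ) * Real.exp (-(ε ^ 2 / (4 * K)))
      ≤ ((max n₁ n₂ : ℕ) : ℝ) ^ (2 : ℤ) * ((max n₁ n₂ : ℕ) : ℝ) ^ (-12 : ℤ) :=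
        mul_le_mul hcard hexp (Real.exp_nonneg _) (zpow_pos hn _).le
    _ = _ := by rw [← zpow_add₀ hn.ne']; norm_num
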